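/- Let $n$ agents choose actions $a_i\in\mathbb R$, and let the payoff-relevant state be $\theta\sim N(\bar\theta,Z)$ in $\mathbb R^m$, where $Z$ is positive semidefinite with $Z_{kk}>0$ for all $k$. Agent $i$'s payoff is $$u_i(a,\theta)=\Big(\sum_{k} r_{ik}\theta_k-\sum_{j\ne i}q_{ij}a_j\Big)a_i-\frac{q_{ii}}2a_i^2+\bar u_i(a_{-i},\theta),$$ where $Q=[q_{ij}]$, $R=[r_{ik}]$ are real matrices with $Q+Q^\top$ positive definite and $\bar u_i$ is an arbitrary function. The designer's objective is $$v(a,\theta)=\begin{bmatrix}a\\ \theta\end{bmatrix}^\top\begin{bmatrix}V&W/2\\W^\top/2&O\end{bmatrix}\begin{bmatrix}a\\ \theta\end{bmatrix}+\bar v(a,\theta),$$ with $V\in\mathbb R^{n\times n}$ symmetric, $W\in\mathbb R^{n\times m}$ and $\bar v$ affine. An information structure $\pi$ is a joint law of signals $(\eta_1,\dots,\eta_n)$, with values in arbitrary measurable spaces, and the state $\theta$, whose $\theta$-marginal is $N(\bar\theta,Z)$; it is Gaussian if the signals are real (vector-)valued and $(\eta,\theta)$ is jointly normal (possibly degenerate).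 A strategy of agent $i$ is a measurable function $\sigma_i$ of $\eta_i$ with $E|\sigma_i(\eta_i)|^2<\infty$. A profile $\sigma$ is a Bayes Nash equilibrium (BNE) under $\pi$ if for every agent $i$ and every $a_i\in\mathbb R$, almost surely, $E[u_i((a_i,\sigma_{-i}),\theta)-u_i((\sigma_i,\sigma_{-i}),\theta)\mid\eta_i]\le 0$, that is, $\sigma_i(\eta_i)$ maximizes $i$'s conditional expected payoff given $\eta_i$. The value of $\pi$ under a BNE $\sigma$ is $E[v(\sigma,\theta)]$, and $\pi$ is optimal if it has a BNE and the value of $\pi$ under each of its BNE is at least the value of every information structure $\pi'$ under every BNE of $\pi'$. Then: 1. There exists an optimal information structure that is Gaussian (it can be taken with one-dimensional real signals). 2. If $\sigma$ is a BNE under an arbitrary information structure $\pi$, then the covariance matrix of $(\sigma,\theta)$ under $\pi$ has the form $\mathbf M_{X,Y}=\begin{bmatrix}X&Y\\Y^\top&Z\end{bmatrix}$ with $X\in\mathbb R^{n\times n}$, $Y\in\mathbb R^{n\times m}$ satisfying $$\operatorname{diag}(XQ^\top)=\operatorname{diag}(YR^\top)\quad\text{and}\quad \mathbf M_{X,Y}\succeq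 O.\qquad(*)$$ Conversely, for all $X,Y$ satisfying $(*)$ there is a Gaussian information structure (with one-dimensional real signals) that has a BNE and under every BNE of which the covariance matrix of $(\sigma,\theta)$ is $\mathbf M_{X,Y}$. -/

import Mathlib

universe u v

namespace LQG

open scoped Matrix

/-- Data of a linear-quadratic-Gaussian information design problem with `n` agents and an
`m`-dimensional state.  `Q`, `R` are the coefficients of the agents' payoffs, `ubar i` is the
arbitrary pure externality of agent `i` (a function of the opponents' actions and of the state),
`thetaBar` and `Z` are the mean and the variance of the state, and `V` (symmetric), `W`, `vbar`
are the coefficients and the affine part of the designer's objective. -/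
structure Environment (n m : ℕ) where
  Q : Matrix (Fin n) (Fin n) ℝ
  R : Matrix (Fin n) (Fin m) ℝ
  ubar : ∀ i : Fin n, ({j : Fin n // j ≠ i} → ℝ) → EuclideanSpace ℝ (Fin m) → ℝ
  thetaBar : EuclideanSpace ℝ (Fin m)
  Z : Matrix (Fin m) (Fin m) ℝ
  V : Matrix (Fin n) (Fin n) ℝ
  V_symm : V.IsSymm
  W : Matrix (Fin n) (Fin m) ℝ
  vbar : ((Fin n → ℝ) × EuclideanSpace ℝ (Fin m)) →ᵃ[ℝ] ℝ

namespace Environment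

variable {n m : ℕ} (E : Environment n m)

/-- The regularity assumption: `Q + Qᵀ` is positive definite, and `Z` is a positive semidefinite
matrix with positive diagonal entries (the variances of the coordinates of the state). -/
structure BasicAssumption : Prop where
  posDef : (E.Q + E.Qᵀ).PosDef
  posSemidef : E.Z.PosSemidef
  diag_pos : ∀ k, 0 < E.Z k k

/-- The payoff of agent `i` at the action profile `a` and the state `θ`:
`(∑ₖ rᵢₖ θₖ - ∑_{j ≠ i} qᵢⱼ aⱼ) aᵢ - (qᵢᵢ / 2) aᵢ² + ubarᵢ (a₋ᵢ, θ)`. -/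
noncomputable def payoff (i : Fin n) (a : Fin n → ℝ) (θ : EuclideanSpace ℝ (Fin m)) : ℝ :=
  ((∑ k, E.R i k * θ k) - ∑ j ∈ Finset.univ.erase i, E.Q i j * a j) * a i
    - E.Q i i / 2 * a i ^ 2 + E.ubar i (fun j => a j) θ

/-- The symmetric block matrix `[V, W/2; Wᵀ/2, 0]`. -/
noncomputable def objMatrix : Matrix (Fin n ⊕ Fin m) (Fin n ⊕ Fin m) ℝ :=
  Matrix.fromBlocks E.V ((1 / 2 : ℝ) • E.W) ((1 / 2 : ℝ) • E.Wᵀ) 0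

/-- The designer's objective: the quadratic form of `objMatrix` at the stacked vector `(a, θ)`
plus the affine term. -/
noncomputable def objective (a : Fin n → ℝ) (θ : EuclideanSpace ℝ (Fin m)) : ℝ :=
  (Sum.elim a θ.ofLp ⬝ᵥ (E.objMatrix *ᵥ Sum.elim a θ.ofLp)) + E.vbar (a, θ)

/-- The block matrix `[X, Y; Yᵀ, Z]`. -/
def momentMatrix (X : Matrix (Fin n) (Fin n) ℝ) (Y : Matrix (Fin n) (Fin m) ℝ) :
    Matrix (Fin n ⊕ Fin m) (Fin n ⊕ Fin m) ℝ :=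
  Matrix.fromBlocks X Y Yᵀ E.Z

/-- Feasibility of `(X, Y)`: the obedience constraints `diag (X Qᵀ) = diag (Y Rᵀ)`, and positive
semidefiniteness (which includes symmetry) of `[X, Y; Yᵀ, Z]`. -/
def Feasible (X : Matrix (Fin n) (Fin n) ℝ) (Y : Matrix (Fin n) (Fin m) ℝ) : Prop :=
  (X * E.Qᵀ).diag = (Y * E.Rᵀ).diag ∧ (E.momentMatrix X Y).PosSemidef

end Environment

/-- An information structure in which the signal of agent `i` takes values in the measurable space
`S i`: a joint law of the signal profile and the state whose state marginal is the prior
`N(thetaBar, Z)`.  (It is a probability measure because the prior is one.) -/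
structure InfoStructure {n m : ℕ} (E : Environment n m) (S : Fin n → Type u)
    [∀ i, MeasurableSpace (S i)] where
  law : MeasureTheory.Measure ((∀ i, S i) × EuclideanSpace ℝ (Fin m))
  prior : law.map Prod.snd = ProbabilityTheory.multivariateGaussian E.thetaBar E.Z

namespace InfoStructure

variable {n m : ℕ} {E : Environment n m}

/-- An information structure with vector-valued signals is Gaussian if the signal profile and the
state are jointly normal (possibly with a singular variance matrix). -/
def IsGaussian {S : Fin n → Type u} [∀ i, NormedAddCommGroup (S i)] [∀ i, NormedSpace ℝ (S i)]
    [∀ i, FiniteDimensional ℝ (S i)] [∀ i, MeasurableSpace (S i)] [∀ i, BorelSpace (S i)]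
    (π : InfoStructure E S) : Prop :=
  ProbabilityTheory.IsGaussian π.law

variable {S : Fin n → Type u} [∀ i, MeasurableSpace (S i)]

/-- The realized action profile under the strategy profile `σ`. -/
def actions (σ : ∀ i, S i → ℝ) (ω : (∀ i, S i) × EuclideanSpace ℝ (Fin m)) : Fin n → ℝ :=
  fun i => σ i (ω.1 i)

/-- Bayes Nash equilibrium.  Strategies are measurable and square integrable, and for every agent
`i` and every action `a`, almost surely, the conditional expectation given the signal of agent `i`
of the gain from playing `a` instead of `σ i` is at most `0`.  The gain is
`uᵢ ((a, σ₋ᵢ), θ) - uᵢ (σ, θ)`; the externality `ubarᵢ`, which need not be integrable or even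
measurable, cancels in it, so that the gain is always an integrable function. Hence the condition
says that `σ i` maximizes the conditional expected payoff of agent `i`. -/
structure IsBNE (π : InfoStructure E S) (σ : ∀ i, S i → ℝ) : Prop where
  measurable : ∀ i, Measurable (σ i)
  sq_integrable : ∀ i, MeasureTheory.Integrable (fun ω => σ i (ω.1 i) ^ 2) π.law
  best_response : ∀ (i : Fin n) (a : ℝ), ∀ᵐ ω ∂π.law,
    MeasureTheory.condExp (MeasurableSpace.comap (fun ω => ω.1 i) inferInstance) π.law
      (fun ω => E.payoff i (Function.update (actions σ ω) i a) ω.2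
        - E.payoff i (actions σ ω) ω.2) ω ≤ 0

/-- The designer's expected objective when the agents play `σ` under `π`. -/
noncomputable def value (π : InfoStructure E S) (σ : ∀ i, S i → ℝ) : ℝ :=
  ∫ ω, E.objective (actions σ ω) ω.2 ∂π.law

/-- The covariance matrix of the vector of actions and states when the agents play `σ`. -/
noncomputable def actionStateCov (π : InfoStructure E S) (σ : ∀ i, S i → ℝ) :
    Matrix (Fin n ⊕ Fin m) (Fin n ⊕ Fin m) ℝ :=
  Matrix.of fun p q => ProbabilityTheory.covariance
    (fun ω => Sum.elim (actions σ ω) ω.2.ofLp p)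
    (fun ω => Sum.elim (actions σ ω) ω.2.ofLp q) π.law

/-- `π` is optimal: it has an equilibrium, and every equilibrium of `π` gives the designer at
least the value of any equilibrium under any information structure, with arbitrary measurable
signal spaces. -/
def IsOptimal (π : InfoStructure E S) : Prop :=
  (∃ σ, π.IsBNE σ) ∧
    ∀ σ, π.IsBNE σ →
      ∀ (T : Fin n → Type v) [∀ i, MeasurableSpace (T i)] (π' : InfoStructure E T)
        (σ' : ∀ i, T i → ℝ), π'.IsBNE σ' → π'.value σ' ≤ π.value σ

end InfoStructure

end LQG

open MeasureTheory ProbabilityTheory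
open scoped Matrix RealInnerProductSpace

/-! The payoff of agent `i` is a concave quadratic in the agent's own action, so equilibrium amounts
to a first-order condition: the marginal payoff `∑ₖ rᵢₖ θₖ - ∑ⱼ qᵢⱼ aⱼ` has zero conditional mean
given the signal of `i`. It is thus orthogonal to every square-integrable function of that signal.
Testing against constants determines the mean of play, since `Q` is invertible; testing against the
agent's own action gives the obedience constraint; testing against the difference of two equilibria
gives essential uniqueness, since the quadratic form of `Q` is positive.

Conversely, given a feasible covariance, draw recommendations and state jointly normal with that
covariance and the forced mean. Obedience makes each marginal payoff uncorrelated with the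
recommendation; under joint normality it is then independent of it, so its conditional mean is its
mean, zero.

The value of an equilibrium is a constant plus a linear functional of the covariance. The feasible
set is nonempty and compact: coercivity of `Q` and the obedience constraint bound the trace of `X`.
A maximizer of the functional is implemented by Gaussian recommendations, and is compared with any
information structure through its covariance alone. -/

namespace LQG

/-! ### Marginal payoffs and invertibility of `Q` -/

namespace Environment

variable {n m : ℕ} (E : Environment n m)

/-- The coefficients, in the stacked vector `(a, θ)`, of the marginal payoff
`∑ₖ rᵢₖ θₖ - ∑ⱼ qᵢⱼ aⱼ` of agent `i`. -/
def marginalCoeff (i : Fin n) : Fin n ⊕ Fin m → ℝ :=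
  Sum.elim (fun j => -E.Q i j) (E.R i)

/-- The derivative `∑ₖ rᵢₖ θₖ - ∑ⱼ qᵢⱼ aⱼ` of the payoff of agent `i` in the agent's own action. -/
def marginal (i : Fin n) (a : Fin n → ℝ) (θ : EuclideanSpace ℝ (Fin m)) : ℝ :=
  ∑ p, E.marginalCoeff i p * Sum.elim a θ.ofLp p

theorem marginal_eq (i : Fin n) (a : Fin n → ℝ) (θ : EuclideanSpace ℝ (Fin m)) :
    E.marginal i a θ = (∑ k, E.R i k * θ k) - ∑ j, E.Q i j * a j := by
  simp [marginal, marginalCoeff, Fintype.sum_sum_type]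
  ring

/-- The externality ignores the agent's own action and cancels; the rest is a quadratic in that
action, so its second-order expansion at `a i` is exact. -/
theorem payoff_update_sub (i : Fin n) (a : Fin n → ℝ) (θ : EuclideanSpace ℝ (Fin m)) (b : ℝ) :
    E.payoff i (Function.update a i b) θ - E.payoff i a θ =
      E.marginal i a θ * (b - a i) - E.Q i i / 2 * (b - a i) ^ 2 := by
  have h1 : ∑ j ∈ Finset.univ.erase i, E.Q i j * Function.update a i b j =
      ∑ j ∈ Finset.univ.erase i, E.Q i j * a j :=
    Finset.sum_congr rfl fun j hj => by
      rw [Function.update_of_ne (Finset.ne_of_mem_erase hj)]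
  have h2 : (fun j : {j : Fin n // j ≠ i} => Function.update a i b j) =
      fun j : {j : Fin n // j ≠ i} => a j := by
    funext j
    rw [Function.update_of_ne j.2]
  have h3 := Finset.add_sum_erase Finset.univ (fun j => E.Q i j * a j) (Finset.mem_univ i)
  rw [marginal_eq, payoff, payoff, h1, h2, ← h3]
  simp only [Function.update_self]
  ring

/-- The mean action profile in every equilibrium. -/
noncomputable def meanAction : Fin n → ℝ := E.Q⁻¹ *ᵥ (E.R *ᵥ E.thetaBar.ofLp)

/-- The mean of the stacked vector of actions and states in every equilibrium. -/
noncomputable def meanVec : Fin n ⊕ Fin m → ℝ := Sum.elim E.meanAction E.thetaBar.ofLp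

namespace BasicAssumption

variable {E} (hE : E.BasicAssumption)

include hE

theorem quadForm_pos {x : Fin n → ℝ} (hx : x ≠ 0) : 0 < x ⬝ᵥ (E.Q *ᵥ x) := by
  have h := hE.posDef.dotProduct_mulVec_pos hx
  rw [Matrix.add_mulVec, dotProduct_add, star_trivial, Matrix.mulVec_transpose,
    dotProduct_comm x (x ᵥ* E.Q), ← Matrix.dotProduct_mulVec] at h
  linarith

theorem quadForm_nonneg (x : Fin n → ℝ) : 0 ≤ x ⬝ᵥ (E.Q *ᵥ x) := by
  by_cases hx : x = 0
  · simp [hx]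
  · exact (hE.quadForm_pos hx).le

theorem Q_diag_pos (i : Fin n) : 0 < E.Q i i := by
  have := hE.posDef.diag_pos (i := i)
  simp at this
  linarith

/-- `Q` need not be symmetric, but a kernel vector would annihilate its positive quadratic form. -/
theorem isUnit_Q : IsUnit E.Q := by
  rw [← Matrix.mulVec_injective_iff_isUnit]
  intro x y hxy
  by_contra hne
  have h := hE.quadForm_pos (sub_ne_zero.mpr hne)
  have h0 : E.Q *ᵥ (x - y) = 0 := by
    rw [Matrix.mulVec_sub]
    exact sub_eq_zero.mpr hxy
  simp [h0] at h

theorem Q_mulVec_meanAction : E.Q *ᵥ E.meanAction = E.R *ᵥ E.thetaBar.ofLp := by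
  rw [meanAction, Matrix.mulVec_mulVec, Matrix.mul_nonsing_inv _
    ((Matrix.isUnit_iff_isUnit_det _).mp hE.isUnit_Q), Matrix.one_mulVec]

theorem eq_meanAction {x : Fin n → ℝ} (hx : E.Q *ᵥ x = E.R *ᵥ E.thetaBar.ofLp) :
    x = E.meanAction :=
  Matrix.mulVec_injective_iff_isUnit.mpr hE.isUnit_Q (hx.trans hE.Q_mulVec_meanAction.symm)

end BasicAssumption

end Environment

/-! ### First-order conditions and essential uniqueness of equilibrium -/

namespace InfoStructure

variable {n m : ℕ} {E : Environment n m} {S : Fin n → Type u} [∀ i, MeasurableSpace (S i)]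
  (π : InfoStructure E S) {σ τ : ∀ i, S i → ℝ}

instance isProbabilityMeasure_law : IsProbabilityMeasure π.law := by
  have : IsProbabilityMeasure (π.law.map Prod.snd) := by
    rw [π.prior]
    infer_instance
  exact Measure.isProbabilityMeasure_of_map Prod.snd

/-- The stacked vector of the realized actions and the state. -/
def actionState (σ : ∀ i, S i → ℝ) (ω : (∀ i, S i) × EuclideanSpace ℝ (Fin m)) :
    Fin n ⊕ Fin m → ℝ :=
  Sum.elim (actions σ ω) ω.2.ofLp

theorem measurePreserving_snd : MeasurePreserving Prod.snd π.law
    (multivariateGaussian E.thetaBar E.Z) :=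
  ⟨measurable_snd, π.prior⟩

theorem memLp_state (k : Fin m) : MemLp (fun ω => ω.2 k) 2 π.law := by
  have h : MemLp (fun x : EuclideanSpace ℝ (Fin m) => x k) 2
      (multivariateGaussian E.thetaBar E.Z) :=
    (EuclideanSpace.proj (𝕜 := ℝ) k).comp_memLp' IsGaussian.memLp_two_id
  exact h.comp_measurePreserving π.measurePreserving_snd

theorem integral_state (k : Fin m) : ∫ ω, ω.2 k ∂π.law = E.thetaBar k := by
  rw [← integral_map (φ := Prod.snd) (f := fun x : EuclideanSpace ℝ (Fin m) => x k)
    measurable_snd.aemeasurable (by fun_prop), π.prior]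
  have h := (EuclideanSpace.proj (𝕜 := ℝ) k).integral_comp_comm
    (IsGaussian.integrable_id (μ := multivariateGaussian E.thetaBar E.Z))
  simpa using h

theorem covariance_state (hZ : E.Z.PosSemidef) (k l : Fin m) :
    cov[fun ω => ω.2 k, fun ω => ω.2 l; π.law] = E.Z k l := by
  rw [← covariance_eval_multivariateGaussian (μ := E.thetaBar) hZ, ← π.prior,
    covariance_map_fun (by fun_prop) (by fun_prop) measurable_snd.aemeasurable]

/-- A strategy profile is admissible if it is measurable and square integrable. -/
structure IsAdmissible (π : InfoStructure E S) (σ : ∀ i, S i → ℝ) : Prop where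
  measurable : ∀ i, Measurable (σ i)
  sq_integrable : ∀ i, Integrable (fun ω => σ i (ω.1 i) ^ 2) π.law

variable {π}

theorem IsBNE.isAdmissible (h : π.IsBNE σ) : π.IsAdmissible σ := ⟨h.measurable, h.sq_integrable⟩

theorem measurable_signal (i : Fin n) :
    Measurable (fun ω : (∀ i, S i) × EuclideanSpace ℝ (Fin m) => ω.1 i) :=
  (measurable_pi_apply i).comp measurable_fst

theorem comap_signal_le (i : Fin n) :
    MeasurableSpace.comap (fun ω : (∀ i, S i) × EuclideanSpace ℝ (Fin m) => ω.1 i) inferInstance ≤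
      Prod.instMeasurableSpace :=
  (measurable_signal i).comap_le

namespace IsAdmissible

theorem memLp_action (h : π.IsAdmissible σ) (i : Fin n) :
    MemLp (fun ω => σ i (ω.1 i)) 2 π.law :=
  (memLp_two_iff_integrable_sq
    ((h.measurable i).comp (measurable_signal i)).aestronglyMeasurable).mpr (h.sq_integrable i)

theorem memLp_actionState (h : π.IsAdmissible σ) (p : Fin n ⊕ Fin m) :
    MemLp (fun ω => actionState σ ω p) 2 π.law := by
  rcases p with i | k
  · exact h.memLp_action i
  · exact π.memLp_state k

theorem memLp_marginal (h : π.IsAdmissible σ) (i : Fin n) :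
    MemLp (fun ω => E.marginal i (actions σ ω) ω.2) 2 π.law :=
  memLp_finsetSum _ fun p _ => (h.memLp_actionState p).const_mul _

theorem integral_marginal (h : π.IsAdmissible σ) (i : Fin n) :
    ∫ ω, E.marginal i (actions σ ω) ω.2 ∂π.law =
      ∑ p, E.marginalCoeff i p * ∫ ω, actionState σ ω p ∂π.law := by
  change ∫ ω, ∑ p, E.marginalCoeff i p * actionState σ ω p ∂π.law = _
  rw [integral_finsetSum _ fun p _ =>
    ((h.memLp_actionState p).integrable one_le_two).const_mul _]
  simp only [integral_const_mul]

theorem covariance_marginal (h : π.IsAdmissible σ) (i : Fin n) :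
    cov[fun ω => E.marginal i (actions σ ω) ω.2, fun ω => σ i (ω.1 i); π.law] =
      ∑ p, E.marginalCoeff i p * π.actionStateCov σ p (Sum.inl i) := by
  change cov[fun ω => ∑ p, E.marginalCoeff i p * actionState σ ω p, _; π.law] = _
  rw [covariance_fun_sum_left (X := fun p ω => E.marginalCoeff i p * actionState σ ω p)
    (fun p => (h.memLp_actionState p).const_mul _) (h.memLp_action i)]
  simp only [covariance_const_mul_left]
  rfl

/-- The conditional expected gain from a deviation, in terms of the conditional expectation of the
marginal payoff. -/
theorem condExp_gain (h : π.IsAdmissible σ) (i : Fin n) (a : ℝ) :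
    π.law[fun ω => E.payoff i (Function.update (actions σ ω) i a) ω.2
        - E.payoff i (actions σ ω) ω.2 |
      MeasurableSpace.comap (fun ω => ω.1 i) inferInstance] =ᵐ[π.law]
    fun ω => (π.law[fun ω => E.marginal i (actions σ ω) ω.2 |
      MeasurableSpace.comap (fun ω => ω.1 i) inferInstance]) ω * (a - σ i (ω.1 i))
        - E.Q i i / 2 * (a - σ i (ω.1 i)) ^ 2 := by
  set 𝓕 : MeasurableSpace ((∀ i, S i) × EuclideanSpace ℝ (Fin m)) :=
    MeasurableSpace.comap (fun ω => ω.1 i) inferInstance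
  have hdev : StronglyMeasurable[𝓕] fun ω : (∀ i, S i) × EuclideanSpace ℝ (Fin m) =>
      a - σ i (ω.1 i) :=
    (measurable_const.sub ((h.measurable i).comp (comap_measurable _))).stronglyMeasurable
  have hdevLp : MemLp (fun ω => a - σ i (ω.1 i)) 2 π.law :=
    (memLp_const a).sub (h.memLp_action i)
  have hmul := (h.memLp_marginal i).integrable_mul hdevLp
  have hsq : Integrable (fun ω => E.Q i i / 2 * (a - σ i (ω.1 i)) ^ 2) π.law :=
    hdevLp.integrable_sq.const_mul _
  have hsqm : StronglyMeasurable[𝓕] fun ω : (∀ i, S i) × EuclideanSpace ℝ (Fin m) =>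
      E.Q i i / 2 * (a - σ i (ω.1 i)) ^ 2 := (hdev.pow 2).const_mul _
  have hgain : (fun ω => E.payoff i (Function.update (actions σ ω) i a) ω.2
      - E.payoff i (actions σ ω) ω.2) =
      ((fun ω => E.marginal i (actions σ ω) ω.2) * fun ω => a - σ i (ω.1 i)) -
        fun ω => E.Q i i / 2 * (a - σ i (ω.1 i)) ^ 2 := by
    funext ω
    exact E.payoff_update_sub i _ _ _
  rw [hgain]
  have h1 := condExp_sub hmul hsq 𝓕
  have h2 := condExp_mul_of_stronglyMeasurable_right hdev hmul
    ((h.memLp_marginal i).integrable one_le_two)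
  have h3 := condExp_of_stronglyMeasurable (μ := π.law) (comap_signal_le i) hsqm hsq
  filter_upwards [h1, h2] with ω h1 h2
  rw [h1, Pi.sub_apply, h2, h3, Pi.mul_apply]

/-- A profile with zero conditional expected marginal payoffs is an equilibrium. -/
theorem isBNE (hE : E.BasicAssumption) (h : π.IsAdmissible σ)
    (h0 : ∀ i, π.law[fun ω => E.marginal i (actions σ ω) ω.2 |
      MeasurableSpace.comap (fun ω => ω.1 i) inferInstance] =ᵐ[π.law] 0) : π.IsBNE σ := by
  refine ⟨h.measurable, h.sq_integrable, fun i a => ?_⟩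
  filter_upwards [h.condExp_gain i a, h0 i] with ω h1 h2
  rw [h1, h2, Pi.zero_apply, zero_mul, zero_sub, neg_nonpos]
  have := hE.Q_diag_pos i
  positivity

end IsAdmissible

theorem _root_.eq_zero_of_forall_mul_sub_sq_nonpos {h s q : ℝ} (hq : 0 < q)
    (H : ∀ a : ℚ, h * (a - s) - q / 2 * (a - s) ^ 2 ≤ 0) : h = 0 := by
  have H' : ∀ a : ℝ, h * (a - s) - q / 2 * (a - s) ^ 2 ≤ 0 :=
    Rat.isDenseEmbedding_coe_real.dense.induction (by rintro _ ⟨a, rfl⟩; exact H a)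
      (isClosed_le (by fun_prop) (by fun_prop))
  -- This is the maximizer of the concave quadratic in `a`, where the gain is `h ^ 2 / (2 * q)`.
  have h1 := H' (s + h / q)
  have h2 : h * (s + h / q - s) - q / 2 * (s + h / q - s) ^ 2 = h ^ 2 / (2 * q) := by
    field_simp
    ring
  rw [h2, div_le_iff₀ (by positivity), zero_mul] at h1
  exact pow_eq_zero_iff (two_ne_zero) |>.mp (le_antisymm h1 (sq_nonneg h))

namespace IsBNE

variable (hE : E.BasicAssumption)

include hE

theorem condExp_marginal (h : π.IsBNE σ) (i : Fin n) :
    π.law[fun ω => E.marginal i (actions σ ω) ω.2 |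
      MeasurableSpace.comap (fun ω => ω.1 i) inferInstance] =ᵐ[π.law] 0 := by
  -- The exceptional null sets depend on the deviation, so only countably many deviations can be
  -- handled at once; rational ones suffice by density.
  have hgain := ae_all_iff.mpr fun a : ℚ => h.isAdmissible.condExp_gain i (a : ℝ)
  have hbest := ae_all_iff.mpr fun a : ℚ => h.best_response i (a : ℝ)
  filter_upwards [hgain, hbest] with ω h1 h2
  exact eq_zero_of_forall_mul_sub_sq_nonpos (hE.Q_diag_pos i) fun a => (h1 a) ▸ h2 a

/-- In equilibrium, the marginal payoff of an agent is orthogonal to every function of the agent's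
signal. -/
theorem integral_marginal_mul (h : π.IsBNE σ) (i : Fin n) {f : S i → ℝ} (hf : Measurable f)
    (hf2 : MemLp (fun ω => f (ω.1 i)) 2 π.law) :
    ∫ ω, E.marginal i (actions σ ω) ω.2 * f (ω.1 i) ∂π.law = 0 := by
  have hm := h.isAdmissible.memLp_marginal i
  have hsm : StronglyMeasurable[MeasurableSpace.comap (fun ω => ω.1 i) inferInstance]
      fun ω : (∀ i, S i) × EuclideanSpace ℝ (Fin m) => f (ω.1 i) :=
    (hf.comp (comap_measurable _)).stronglyMeasurable
  have h1 := condExp_mul_of_stronglyMeasurable_right hsm (hm.integrable_mul hf2)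
    (hm.integrable one_le_two)
  calc ∫ ω, E.marginal i (actions σ ω) ω.2 * f (ω.1 i) ∂π.law
      = ∫ ω, (π.law[(fun ω => E.marginal i (actions σ ω) ω.2) * fun ω => f (ω.1 i) |
          MeasurableSpace.comap (fun ω => ω.1 i) inferInstance]) ω ∂π.law :=
        (integral_condExp (comap_signal_le i)).symm
    _ = ∫ _, (0 : ℝ) ∂π.law := by
        refine integral_congr_ae ?_
        filter_upwards [h1, h.condExp_marginal hE i] with ω h1 h2
        rw [h1, Pi.mul_apply, h2, Pi.zero_apply, zero_mul]
    _ = 0 := by simp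

theorem integral_marginal (h : π.IsBNE σ) (i : Fin n) :
    ∫ ω, E.marginal i (actions σ ω) ω.2 ∂π.law = 0 := by
  simpa using h.integral_marginal_mul hE i (f := fun _ => 1) measurable_const (memLp_const 1)

/-- The averaged first-order conditions are a linear system for the mean action with invertible
matrix `Q`, so the mean depends on neither the information structure nor the equilibrium. -/
theorem integral_actionState (h : π.IsBNE σ) (p : Fin n ⊕ Fin m) :
    ∫ ω, actionState σ ω p ∂π.law = E.meanVec p := by
  have hmean : (fun i => ∫ ω, σ i (ω.1 i) ∂π.law) = E.meanAction := by
    refine hE.eq_meanAction (funext fun i => ?_)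
    have h1 := h.isAdmissible.integral_marginal i
    rw [h.integral_marginal hE i] at h1
    simp [Environment.marginalCoeff, Fintype.sum_sum_type, actionState, actions,
      integral_state] at h1
    simp only [Matrix.mulVec, dotProduct]
    linarith
  rcases p with i | k
  · exact congrFun hmean i
  · exact π.integral_state k

theorem sum_marginalCoeff_mul_actionStateCov (h : π.IsBNE σ) (i : Fin n) :
    ∑ p, E.marginalCoeff i p * π.actionStateCov σ p (Sum.inl i) = 0 := by
  rw [← h.isAdmissible.covariance_marginal i,
    covariance_eq_sub (h.isAdmissible.memLp_marginal i) (h.isAdmissible.memLp_action i),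
    h.integral_marginal hE i, zero_mul, sub_zero]
  exact h.integral_marginal_mul hE i (h.measurable i) (h.isAdmissible.memLp_action i)

/-- The equilibrium of an information structure is essentially unique. -/
theorem ae_eq (h : π.IsBNE σ) (h' : π.IsBNE τ) :
    ∀ᵐ ω ∂π.law, actions σ ω = actions τ ω := by
  have hd : ∀ i, MemLp (fun ω => σ i (ω.1 i) - τ i (ω.1 i)) 2 π.law := fun i =>
    (h.isAdmissible.memLp_action i).sub (h'.isAdmissible.memLp_action i)
  have hint : ∀ i, Integrable (fun ω => (E.marginal i (actions τ ω) ω.2 -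
      E.marginal i (actions σ ω) ω.2) * (σ i (ω.1 i) - τ i (ω.1 i))) π.law := fun i =>
    ((h'.isAdmissible.memLp_marginal i).sub (h.isAdmissible.memLp_marginal i)).integrable_mul (hd i)
  -- The difference of marginal payoffs is `Q` applied to the difference of actions. The `i`-th
  -- action difference is a function of the signal of `i`, so both equilibria make each summand
  -- integrate to zero.
  have hq : ∀ ω, (actions σ ω - actions τ ω) ⬝ᵥ (E.Q *ᵥ (actions σ ω - actions τ ω)) =
      ∑ i, (E.marginal i (actions τ ω) ω.2 - E.marginal i (actions σ ω) ω.2) *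
        (σ i (ω.1 i) - τ i (ω.1 i)) := by
    intro ω
    simp only [dotProduct]
    refine Finset.sum_congr rfl fun i _ => ?_
    rw [mul_comm]
    congr 1
    simp only [Environment.marginal_eq, Matrix.mulVec, dotProduct, Pi.sub_apply, mul_sub,
      Finset.sum_sub_distrib]
    ring
  have hzero : ∫ ω, (actions σ ω - actions τ ω) ⬝ᵥ (E.Q *ᵥ (actions σ ω - actions τ ω)) ∂π.law
      = 0 := by
    simp only [hq]
    rw [integral_finsetSum _ fun i _ => hint i]
    refine Finset.sum_eq_zero fun i _ => ?_
    have hm : Measurable fun s => σ i s - τ i s := (h.measurable i).sub (h'.measurable i)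
    simp only [sub_mul (E.marginal i _ _)]
    rw [integral_sub (f := fun ω => E.marginal i (actions τ ω) ω.2 * (σ i (ω.1 i) - τ i (ω.1 i)))
      (g := fun ω => E.marginal i (actions σ ω) ω.2 * (σ i (ω.1 i) - τ i (ω.1 i)))
      ((h'.isAdmissible.memLp_marginal i).integrable_mul (hd i))
      ((h.isAdmissible.memLp_marginal i).integrable_mul (hd i)),
      h.integral_marginal_mul hE i hm (hd i), h'.integral_marginal_mul hE i hm (hd i), sub_zero]
  have hintq : Integrable (fun ω =>
      (actions σ ω - actions τ ω) ⬝ᵥ (E.Q *ᵥ (actions σ ω - actions τ ω))) π.law := by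
    simp only [hq]
    exact integrable_finsetSum _ fun i _ => hint i
  rw [integral_eq_zero_iff_of_nonneg (fun ω => hE.quadForm_nonneg _) hintq] at hzero
  filter_upwards [hzero] with ω hω
  by_contra hne
  exact (hE.quadForm_pos (sub_ne_zero.mpr hne)).ne' hω

theorem actionStateCov_eq (h : π.IsBNE σ) (h' : π.IsBNE τ) :
    π.actionStateCov σ = π.actionStateCov τ := by
  have hae : ∀ p, (fun ω => actionState σ ω p) =ᵐ[π.law] fun ω => actionState τ ω p := by
    intro p
    filter_upwards [h.ae_eq hE h'] with ω hω
    simp only [actionState, hω]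
  ext p q
  change cov[fun ω => actionState σ ω p, fun ω => actionState σ ω q; π.law] =
    cov[fun ω => actionState τ ω p, fun ω => actionState τ ω q; π.law]
  simp only [covariance, integral_congr_ae (hae p), integral_congr_ae (hae q)]
  refine integral_congr_ae ?_
  filter_upwards [hae p, hae q] with ω hp hq
  rw [hp, hq]

end IsBNE

/-! ### Feasibility and value in terms of the covariance matrix -/

theorem IsAdmissible.posSemidef_actionStateCov (h : π.IsAdmissible σ) :
    (π.actionStateCov σ).PosSemidef := by
  refine .of_dotProduct_mulVec_nonneg (by ext p q; exact covariance_comm _ _) fun x => ?_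
  have hx : star x ⬝ᵥ (π.actionStateCov σ *ᵥ x) = Var[fun ω => ∑ p, x p * actionState σ ω p; π.law]
      := by
    have hLp := fun p => (h.memLp_actionState p).const_mul (x p)
    rw [← covariance_self (memLp_finsetSum _ fun p _ => hLp p).aestronglyMeasurable.aemeasurable,
      covariance_fun_sum_fun_sum hLp hLp]
    simp only [covariance_const_mul_left, covariance_const_mul_right, dotProduct, Matrix.mulVec,
      Finset.mul_sum, star_trivial]
    refine Finset.sum_congr rfl fun p _ => Finset.sum_congr rfl fun q _ => ?_
    rw [mul_comm (x q), mul_assoc]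
    rfl
  rw [hx]
  exact variance_nonneg _ _

/-- The sum is the `i`-th diagonal entry of `Y Rᵀ - X Qᵀ`, once symmetry of `X` is used. It is also
the covariance of the marginal payoff of `i` with the action of `i`. -/
theorem _root_.LQG.Environment.obedience_iff {X : Matrix (Fin n) (Fin n) ℝ}
    {Y : Matrix (Fin n) (Fin m) ℝ} (hM : (E.momentMatrix X Y).PosSemidef) :
    (X * E.Qᵀ).diag = (Y * E.Rᵀ).diag ↔
      ∀ i, ∑ p, E.marginalCoeff i p * E.momentMatrix X Y p (Sum.inl i) = 0 := by
  have hX : ∀ i j, X j i = X i j := fun i j => hM.isHermitian.apply (Sum.inl i) (Sum.inl j)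
  rw [funext_iff]
  refine forall_congr' fun i => ?_
  simp only [Environment.momentMatrix, Environment.marginalCoeff, Fintype.sum_sum_type,
    Sum.elim_inl, Sum.elim_inr, Matrix.fromBlocks_apply₁₁, Matrix.fromBlocks_apply₂₁,
    Matrix.diag_apply, Matrix.mul_apply, Matrix.transpose_apply, neg_mul, Finset.sum_neg_distrib,
    hX i, mul_comm (E.Q i _), mul_comm (E.R i _)]
  constructor <;> intro h <;> linarith

theorem IsBNE.exists_feasible (hE : E.BasicAssumption) (h : π.IsBNE σ) :
    ∃ (X : Matrix (Fin n) (Fin n) ℝ) (Y : Matrix (Fin n) (Fin m) ℝ),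
      E.Feasible X Y ∧ π.actionStateCov σ = E.momentMatrix X Y := by
  have hpos := h.isAdmissible.posSemidef_actionStateCov
  have hM : π.actionStateCov σ =
      E.momentMatrix (π.actionStateCov σ).toBlocks₁₁ (π.actionStateCov σ).toBlocks₁₂ := by
    ext p q
    rcases p with i | k <;> rcases q with j | l
    · rfl
    · rfl
    · exact covariance_comm _ _
    · exact π.covariance_state hE.posSemidef k l
  refine ⟨_, _, ?_, hM⟩
  rw [hM] at hpos
  refine ⟨(Environment.obedience_iff hpos).mpr fun i => ?_, hpos⟩
  rw [← hM]
  exact h.sum_marginalCoeff_mul_actionStateCov hE i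

theorem _root_.LQG.Environment.exists_vbar_eq_sum (E : Environment n m) :
    ∃ c : Fin n ⊕ Fin m → ℝ, ∃ e : ℝ, ∀ (a : Fin n → ℝ) (θ : EuclideanSpace ℝ (Fin m)),
      E.vbar (a, θ) = ∑ p, c p * Sum.elim a θ.ofLp p + e := by
  let L : (Fin n ⊕ Fin m → ℝ) →ₗ[ℝ] (Fin n → ℝ) × EuclideanSpace ℝ (Fin m) :=
    LinearMap.prod (LinearMap.funLeft ℝ ℝ Sum.inl)
      ((WithLp.linearEquiv 2 ℝ (Fin m → ℝ)).symm.toLinearMap ∘ₗ LinearMap.funLeft ℝ ℝ Sum.inr)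
  refine ⟨fun p => E.vbar.linear (L fun j => if p = j then 1 else 0), E.vbar 0, fun a θ => ?_⟩
  have h1 : E.vbar (a, θ) = E.vbar.linear (a, θ) + E.vbar 0 := congrFun E.vbar.decomp (a, θ)
  have h2 := LinearMap.pi_apply_eq_sum_univ (E.vbar.linear ∘ₗ L) (Sum.elim a θ.ofLp)
  have h3 : L (Sum.elim a θ.ofLp) = (a, θ) := rfl
  rw [LinearMap.comp_apply, h3] at h2
  rw [h1, h2]
  simp [mul_comm]

/-- The value of an equilibrium is an affine function of its action-state covariance matrix. -/
theorem IsBNE.value_eq (hE : E.BasicAssumption) (h : π.IsBNE σ) :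
    π.value σ = ∑ p, ∑ q, E.objMatrix p q * π.actionStateCov σ p q +
      E.objective E.meanAction E.thetaBar := by
  obtain ⟨c, e, hc⟩ := E.exists_vbar_eq_sum
  have hLp := h.isAdmissible.memLp_actionState
  have hobj : ∀ (a : Fin n → ℝ) (θ : EuclideanSpace ℝ (Fin m)), E.objective a θ =
      (∑ p, ∑ q, E.objMatrix p q * (Sum.elim a θ.ofLp p * Sum.elim a θ.ofLp q)) +
        (∑ p, c p * Sum.elim a θ.ofLp p + e) := by
    intro a θ
    rw [Environment.objective, hc]
    congr 1
    simp only [dotProduct, Matrix.mulVec, Finset.mul_sum]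
    refine Finset.sum_congr rfl fun p _ => Finset.sum_congr rfl fun q _ => ?_
    ring
  have hmul : ∀ p q, Integrable (fun ω => actionState σ ω p * actionState σ ω q) π.law :=
    fun p q => (hLp p).integrable_mul (hLp q)
  have hcov : ∀ p q, ∫ ω, actionState σ ω p * actionState σ ω q ∂π.law =
      π.actionStateCov σ p q + E.meanVec p * E.meanVec q := by
    intro p q
    have h1 := covariance_eq_sub (hLp p) (hLp q)
    rw [h.integral_actionState hE, h.integral_actionState hE] at h1
    have h2 : π.actionStateCov σ p q =
      ∫ ω, actionState σ ω p * actionState σ ω q ∂π.law - E.meanVec p * E.meanVec q := h1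
    linarith
  have hI1 : Integrable (fun ω => ∑ p, ∑ q, E.objMatrix p q *
      (actionState σ ω p * actionState σ ω q)) π.law :=
    integrable_finsetSum _ fun p _ => integrable_finsetSum _ fun q _ => (hmul p q).const_mul _
  have hI2 : Integrable (fun ω => ∑ p, c p * actionState σ ω p) π.law :=
    integrable_finsetSum _ fun p _ => ((hLp p).integrable one_le_two).const_mul _
  have hI3 : Integrable (fun ω => ∑ p, c p * actionState σ ω p + e) π.law :=
    hI2.add (integrable_const e)
  have hval : π.value σ = ∫ ω, (∑ p, ∑ q, E.objMatrix p q *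
      (actionState σ ω p * actionState σ ω q)) + (∑ p, c p * actionState σ ω p + e) ∂π.law :=
    integral_congr_ae (ae_of_all _ fun ω => hobj _ _)
  rw [hval, integral_add hI1 hI3,
    integral_add hI2 (integrable_const e), integral_const, probReal_univ, one_smul,
    integral_finsetSum _ fun p _ => ((hLp p).integrable one_le_two).const_mul _,
    integral_finsetSum (f := fun p ω => ∑ q, E.objMatrix p q *
      (actionState σ ω p * actionState σ ω q)) _ fun p _ => integrable_finsetSum _ fun q _ => (hmul p q).const_mul _]
  have hinner : ∀ p, ∫ ω, ∑ q, E.objMatrix p q * (actionState σ ω p * actionState σ ω q) ∂π.law =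
      ∑ q, E.objMatrix p q * π.actionStateCov σ p q +
        ∑ q, E.objMatrix p q * (E.meanVec p * E.meanVec q) := by
    intro p
    rw [integral_finsetSum _ fun q _ => (hmul p q).const_mul _]
    simp only [integral_const_mul, hcov, mul_add, Finset.sum_add_distrib]
  simp only [hinner, integral_const_mul, h.integral_actionState hE, Finset.sum_add_distrib]
  -- The products of means and the affine part reassemble into the objective at the mean vector.
  rw [hobj, add_assoc]
  rfl

end InfoStructure

end LQG

/-! ### Gaussian action recommendations -/

namespace LQG

namespace Environment

variable {n m : ℕ} (E : Environment n m) {X : Matrix (Fin n) (Fin n) ℝ}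
  {Y : Matrix (Fin n) (Fin m) ℝ}

/-- Splitting a stacked vector into the action profile and the state. -/
noncomputable def unstack (n m : ℕ) :
    EuclideanSpace ℝ (Fin n ⊕ Fin m) →L[ℝ] (Fin n → ℝ) × EuclideanSpace ℝ (Fin m) :=
  (ContinuousLinearMap.pi fun i => EuclideanSpace.proj (Sum.inl i)).prod
    ((EuclideanSpace.equiv (Fin m) ℝ).symm.toContinuousLinearMap ∘L
      ContinuousLinearMap.pi fun k => EuclideanSpace.proj (Sum.inr k))

/-- The characteristic function of the state marginal at `t` is that of the joint law at `(0, t)`,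
which only sees the `Z` block and the state mean. -/
theorem map_unstack_snd (hM : (E.momentMatrix X Y).PosSemidef) (hZ : E.Z.PosSemidef) :
    ((multivariateGaussian (WithLp.toLp 2 E.meanVec) (E.momentMatrix X Y)).map
      (unstack n m)).map Prod.snd = multivariateGaussian E.thetaBar E.Z := by
  rw [Measure.map_map measurable_snd (by fun_prop)]
  have : IsProbabilityMeasure (Measure.map (Prod.snd ∘ unstack n m)
      (multivariateGaussian (WithLp.toLp 2 E.meanVec) (E.momentMatrix X Y))) :=
    Measure.isProbabilityMeasure_map (by fun_prop)
  refine Measure.ext_of_charFun (funext fun t => ?_)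
  let t' : EuclideanSpace ℝ (Fin n ⊕ Fin m) := WithLp.toLp 2 (Sum.elim 0 t.ofLp)
  have ht : ∀ x : EuclideanSpace ℝ (Fin n ⊕ Fin m), ⟪(unstack n m x).2, t⟫ = ⟪x, t'⟫ := by
    intro x
    simp [unstack, t', PiLp.inner_apply, Fintype.sum_sum_type]
  have h1 : charFun (Measure.map (Prod.snd ∘ unstack n m)
      (multivariateGaussian (WithLp.toLp 2 E.meanVec) (E.momentMatrix X Y))) t =
      charFun (multivariateGaussian (WithLp.toLp 2 E.meanVec) (E.momentMatrix X Y)) t' := by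
    rw [charFun_apply, charFun_apply, integral_map (by fun_prop) (by fun_prop)]
    simp only [Function.comp_apply, ht]
  rw [h1, charFun_multivariateGaussian hM, charFun_multivariateGaussian hZ]
  have h2 : ⟪t', WithLp.toLp 2 E.meanVec⟫ = ⟪t, E.thetaBar⟫ := by
    simp [t', meanVec, PiLp.inner_apply, Fintype.sum_sum_type]
  have h3 : t'.ofLp ⬝ᵥ E.momentMatrix X Y *ᵥ t'.ofLp = t.ofLp ⬝ᵥ E.Z *ᵥ t.ofLp := by
    simp [t', momentMatrix, Matrix.fromBlocks_mulVec]
  rw [h2, h3]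

/-- The Gaussian information structure with mean `meanVec` and variance `[X, Y; Yᵀ, Z]`, whose
signals are recommended actions. -/
noncomputable def recommendation (hM : (E.momentMatrix X Y).PosSemidef) (hZ : E.Z.PosSemidef) :
    InfoStructure E (fun _ : Fin n => ℝ) where
  law := (multivariateGaussian (WithLp.toLp 2 E.meanVec) (E.momentMatrix X Y)).map (unstack n m)
  prior := E.map_unstack_snd hM hZ

variable {E} (hM : (E.momentMatrix X Y).PosSemidef) (hZ : E.Z.PosSemidef)

theorem isGaussian_recommendation : (E.recommendation hM hZ).IsGaussian :=
  isGaussian_map (unstack n m)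

theorem actionState_unstack (x : EuclideanSpace ℝ (Fin n ⊕ Fin m)) (p : Fin n ⊕ Fin m) :
    InfoStructure.actionState (fun _ => id) (unstack n m x) p = x p := by
  rcases p with i | k <;> simp [unstack, InfoStructure.actionState, InfoStructure.actions]

theorem measurable_actionState_id (p : Fin n ⊕ Fin m) :
    Measurable fun ω : (Fin n → ℝ) × EuclideanSpace ℝ (Fin m) =>
      InfoStructure.actionState (fun _ => id) ω p := by
  rcases p with i | k
  · exact (measurable_pi_apply i).comp measurable_fst
  · exact Measurable.comp (g := fun x : EuclideanSpace ℝ (Fin m) => x k) (by fun_prop)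
      measurable_snd

theorem actionStateCov_recommendation :
    (E.recommendation hM hZ).actionStateCov (fun _ => id) = E.momentMatrix X Y := by
  ext p q
  have h := covariance_map_fun
    (μ := multivariateGaussian (WithLp.toLp 2 E.meanVec) (E.momentMatrix X Y))
    (measurable_actionState_id p).aestronglyMeasurable
    (measurable_actionState_id q).aestronglyMeasurable (Z := unstack n m) (by fun_prop)
  simp only [actionState_unstack] at h
  rw [covariance_eval_multivariateGaussian hM] at h
  exact h

theorem integral_actionState_recommendation (p : Fin n ⊕ Fin m) :
    ∫ ω, InfoStructure.actionState (fun _ => id) ω p ∂(E.recommendation hM hZ).law =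
      E.meanVec p := by
  rw [recommendation, integral_map (by fun_prop)
    (measurable_actionState_id p).aestronglyMeasurable]
  simp only [actionState_unstack]
  have h := (EuclideanSpace.proj (𝕜 := ℝ) p).integral_comp_comm
    (IsGaussian.integrable_id
      (μ := multivariateGaussian (WithLp.toLp 2 E.meanVec) (E.momentMatrix X Y)))
  simpa using h

theorem isAdmissible_recommendation :
    (E.recommendation hM hZ).IsAdmissible fun _ => id := by
  refine ⟨fun _ => measurable_id, fun i => ?_⟩
  have : ProbabilityTheory.IsGaussian (E.recommendation hM hZ).law := isGaussian_recommendation hM hZ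
  exact ((ContinuousLinearMap.proj (R := ℝ) (φ := fun _ : Fin n => ℝ) i ∘L
    ContinuousLinearMap.fst ℝ (Fin n → ℝ) (EuclideanSpace ℝ (Fin m))).comp_memLp'
      IsGaussian.memLp_two_id).integrable_sq

/-- The marginal payoff under obedience, as a continuous linear map. -/
noncomputable def marginalCLM (E : Environment n m) (i : Fin n) :
    (Fin n → ℝ) × EuclideanSpace ℝ (Fin m) →L[ℝ] ℝ :=
  (∑ j, (-E.Q i j) • (ContinuousLinearMap.proj (R := ℝ) (φ := fun _ : Fin n => ℝ) j ∘L
    ContinuousLinearMap.fst ℝ _ _)) +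
  ∑ k, (E.R i k) • (EuclideanSpace.proj (𝕜 := ℝ) k ∘L ContinuousLinearMap.snd ℝ _ _)

theorem marginalCLM_apply (i : Fin n) (ω : (Fin n → ℝ) × EuclideanSpace ℝ (Fin m)) :
    E.marginalCLM i ω = E.marginal i (InfoStructure.actions (fun _ => id) ω) ω.2 := by
  simp [marginalCLM, marginal, marginalCoeff, Fintype.sum_sum_type, InfoStructure.actions]

/-- Obedience says that the marginal payoff and the recommendation are uncorrelated; being jointly
Gaussian, they are independent. The conditional mean is therefore the plain mean, which vanishes by
the choice of `meanVec`. -/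
theorem isBNE_recommendation (hE : E.BasicAssumption) (hF : E.Feasible X Y) :
    (E.recommendation hF.2 hE.posSemidef).IsBNE fun _ => id := by
  have hadm := isAdmissible_recommendation hF.2 hE.posSemidef
  have hG : ProbabilityTheory.IsGaussian (E.recommendation hF.2 hE.posSemidef).law :=
    isGaussian_recommendation hF.2 hE.posSemidef
  refine hadm.isBNE hE fun i => ?_
  have hcov := hadm.covariance_marginal i
  rw [actionStateCov_recommendation, (obedience_iff hF.2).mp hF.1 i] at hcov
  have hmean := hadm.integral_marginal i
  simp only [integral_actionState_recommendation] at hmean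
  have hmean0 : ∑ p, E.marginalCoeff i p * E.meanVec p = 0 := by
    have h := congrFun hE.Q_mulVec_meanAction i
    simp only [Matrix.mulVec, dotProduct] at h
    simp only [marginalCoeff, meanVec, Fintype.sum_sum_type, Sum.elim_inl, Sum.elim_inr, neg_mul,
      Finset.sum_neg_distrib]
    linarith
  rw [hmean0] at hmean
  let L : (Fin n → ℝ) × EuclideanSpace ℝ (Fin m) →L[ℝ] ℝ × ℝ := (E.marginalCLM i).prod
    (ContinuousLinearMap.proj (R := ℝ) (φ := fun _ : Fin n => ℝ) i ∘L ContinuousLinearMap.fst ℝ _ _)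
  have hlaw : HasGaussianLaw (fun ω : (Fin n → ℝ) × EuclideanSpace ℝ (Fin m) =>
      (E.marginal i (InfoStructure.actions (fun _ => id) ω) ω.2, ω.1 i))
      (E.recommendation hF.2 hE.posSemidef).law := by
    refine ⟨?_⟩
    have hL : (fun ω : (Fin n → ℝ) × EuclideanSpace ℝ (Fin m) =>
        (E.marginal i (InfoStructure.actions (fun _ => id) ω) ω.2, ω.1 i)) = L := by
      funext ω
      rw [← marginalCLM_apply]
      rfl
    rw [hL]
    exact isGaussian_map L
  have hind := hlaw.indepFun_of_covariance_eq_zero hcov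
  have hmeas : Measurable fun ω : (Fin n → ℝ) × EuclideanSpace ℝ (Fin m) =>
      E.marginal i (InfoStructure.actions (fun _ => id) ω) ω.2 := by
    simp only [← marginalCLM_apply]
    exact (E.marginalCLM i).continuous.measurable
  have h := condExp_indep_eq hmeas.comap_le (InfoStructure.comap_signal_le i)
    (comap_measurable _).stronglyMeasurable ((IndepFun_iff_Indep _ _ _).mp hind)
  rw [hmean] at h
  exact h

end Environment

end LQG

/-! ### Compactness of the feasible set and existence of a maximizer -/

theorem Matrix.PosSemidef.two_mul_abs_apply_le {ι : Type*} [Fintype ι] [DecidableEq ι]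
    {M : Matrix ι ι ℝ} (hM : M.PosSemidef) (p q : ι) {ε : ℝ} (hε : 0 < ε) :
    2 * |M p q| ≤ ε * M p p + M q q / ε := by
  have hsymm : M q p = M p q := hM.isHermitian.apply p q
  have key : ∀ t : ℝ, 0 ≤ ε ^ 2 * M p p + 2 * ε * t * M p q + t ^ 2 * M q q := by
    intro t
    have h := hM.dotProduct_mulVec_nonneg (ε • Pi.single p 1 + t • Pi.single q 1)
    simp [Matrix.mulVec_add, Matrix.mulVec_smul, hsymm] at h
    linarith
  have h1 := key 1
  have h2 := key (-1)
  have h3 : 2 * ε * |M p q| ≤ ε ^ 2 * M p p + M q q := by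
    rcases abs_cases (M p q) with ⟨h, _⟩ | ⟨h, _⟩ <;> rw [h] <;> linarith
  have h4 : ε * M p p + M q q / ε = (ε ^ 2 * M p p + M q q) / ε := by
    field_simp
  rw [h4, le_div_iff₀ hε]
  linarith

namespace LQG

namespace Environment

variable {n m : ℕ} {E : Environment n m} (hE : E.BasicAssumption)

include hE

theorem BasicAssumption.exists_coercive :
    ∃ c : ℝ, 0 < c ∧ ∀ x : Fin n → ℝ, c * (x ⬝ᵥ x) ≤ x ⬝ᵥ (E.Q *ᵥ x) := by
  have hcont : Continuous fun x : EuclideanSpace ℝ (Fin n) => x.ofLp ⬝ᵥ (E.Q *ᵥ x.ofLp) := by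
    have : Continuous fun x : EuclideanSpace ℝ (Fin n) => x.ofLp := PiLp.continuous_ofLp 2 _
    exact this.dotProduct (continuous_const.matrix_mulVec this)
  -- The constant is the minimum of the form on the unit sphere. An empty sphere leaves only `x =
  -- 0`, where any constant works.
  rcases (Metric.sphere (0 : EuclideanSpace ℝ (Fin n)) 1).eq_empty_or_nonempty with hS | hS
  · refine ⟨1, one_pos, fun x => ?_⟩
    have hx : x = 0 := by
      by_contra hx
      have hx' : WithLp.toLp 2 x ≠ (0 : EuclideanSpace ℝ (Fin n)) := fun h =>
        hx (congrArg WithLp.ofLp h)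
      have hmem : ‖WithLp.toLp 2 x‖⁻¹ • WithLp.toLp 2 x ∈
          Metric.sphere (0 : EuclideanSpace ℝ (Fin n)) 1 := by
        simpa using norm_smul_inv_norm (𝕜 := ℝ) hx'
      simp [hS] at hmem
    simp [hx]
  · obtain ⟨y, hy, hmin⟩ := (isCompact_sphere _ _).exists_isMinOn hS hcont.continuousOn
    have hy0 : y.ofLp ≠ 0 := by
      intro h
      have h0 : y = 0 := WithLp.ofLp_injective 2 h
      simp [h0] at hy
    refine ⟨_, hE.quadForm_pos hy0, fun x => ?_⟩
    by_cases hx : x = 0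
    · simp [hx]
    have hx' : WithLp.toLp 2 x ≠ (0 : EuclideanSpace ℝ (Fin n)) := fun h =>
      hx (congrArg WithLp.ofLp h)
    have hmem : ‖WithLp.toLp 2 x‖⁻¹ • WithLp.toLp 2 x ∈
        Metric.sphere (0 : EuclideanSpace ℝ (Fin n)) 1 := by
      simpa using norm_smul_inv_norm (𝕜 := ℝ) hx'
    have h := hmin hmem
    have hpos : 0 < ‖WithLp.toLp 2 x‖ := norm_pos_iff.mpr hx'
    have hsq : x ⬝ᵥ x = ‖WithLp.toLp 2 x‖ ^ 2 := by
      rw [EuclideanSpace.real_norm_sq_eq]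
      simp [dotProduct, sq]
    simp only [Set.mem_ofPred_eq, WithLp.ofLp_smul, Matrix.mulVec_smul, smul_dotProduct,
      dotProduct_smul, smul_eq_mul] at h
    rw [hsq, ← le_div_iff₀ (by positivity)]
    refine h.trans_eq ?_
    field_simp

/-- Summing the obedience constraints gives `c tr X ≤ tr (X Qᵀ) = tr (Y Rᵀ)`. The right side grows
only like the square root of `tr X`, because the entries of `Y` are controlled by the diagonals of
`X` and `Z`. -/
theorem exists_trace_le : ∃ B : ℝ, ∀ (X : Matrix (Fin n) (Fin n) ℝ) (Y : Matrix (Fin n) (Fin m) ℝ),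
    E.Feasible X Y → X.trace ≤ B := by
  obtain ⟨c, hc, hcoer⟩ := BasicAssumption.exists_coercive hE
  set r := ∑ i, ∑ k, |E.R i k| with hr
  have hr0 : 0 ≤ r := Finset.sum_nonneg fun i _ => Finset.sum_nonneg fun k _ => abs_nonneg _
  -- Chosen so that `r * ε ≤ c`: the bound on `tr (Y Rᵀ)` then costs at most half of `c tr X`. The
  -- `+ 1` covers `R = 0`.
  set ε := c / (r + 1) with hε
  have hε0 : 0 < ε := by positivity
  have hrε : r * ε ≤ c := by
    rw [hε, mul_div_assoc', div_le_iff₀ (by positivity)]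
    nlinarith
  refine ⟨r * (E.Z.trace / ε) / c, fun X Y hF => ?_⟩
  have hXpos : X.PosSemidef := hF.2.submatrix Sum.inl
  have hXdiag : ∀ i, X i i ≤ X.trace := fun i =>
    Finset.single_le_sum (f := fun i => X i i) (fun j _ => hXpos.diag_nonneg) (Finset.mem_univ i)
  have hZdiag : ∀ k, E.Z k k ≤ E.Z.trace := fun k =>
    Finset.single_le_sum (f := fun k => E.Z k k) (fun j _ => hE.posSemidef.diag_nonneg)
      (Finset.mem_univ k)
  have hlow : c * X.trace ≤ (X * E.Qᵀ).trace := by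
    -- Written as a sum of rank-one matrices `w wᵀ`, `X` reduces the inequality to coercivity at
    -- each `w`.
    obtain ⟨d, w, hw⟩ := Matrix.posSemidef_iff_eq_sum_vecMulVec.mp hXpos
    rw [hw, Matrix.trace_sum, Finset.sum_mul, Matrix.trace_sum, Finset.mul_sum]
    refine Finset.sum_le_sum fun k _ => ?_
    have h := hcoer (w k)
    rw [star_trivial, Matrix.trace_vecMulVec, Matrix.vecMulVec_mul, Matrix.trace_vecMulVec,
      Matrix.vecMul_transpose]
    exact h
  have hup : (Y * E.Rᵀ).trace ≤ r * ((ε * X.trace + E.Z.trace / ε) / 2) := by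
    simp only [Matrix.trace, Matrix.diag_apply, Matrix.mul_apply, Matrix.transpose_apply]
    rw [hr, Finset.sum_mul]
    refine Finset.sum_le_sum fun i _ => ?_
    rw [Finset.sum_mul]
    refine Finset.sum_le_sum fun k _ => ?_
    have h := hF.2.two_mul_abs_apply_le (Sum.inl i) (Sum.inr k) hε0
    change 2 * |Y i k| ≤ ε * X i i + E.Z k k / ε at h
    have h2 : |Y i k| ≤ (ε * X.trace + E.Z.trace / ε) / 2 := by
      have h3 : ε * X i i ≤ ε * X.trace := mul_le_mul_of_nonneg_left (hXdiag i) hε0.le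
      have h4 : E.Z k k / ε ≤ E.Z.trace / ε := div_le_div_of_nonneg_right (hZdiag k) hε0.le
      linarith
    calc Y i k * E.R i k ≤ |Y i k * E.R i k| := le_abs_self _
      _ = |E.R i k| * |Y i k| := by rw [abs_mul, mul_comm]
      _ ≤ |E.R i k| * ((ε * X.trace + E.Z.trace / ε) / 2) :=
        mul_le_mul_of_nonneg_left h2 (abs_nonneg _)
  have heq : (X * E.Qᵀ).trace = (Y * E.Rᵀ).trace := congrArg (fun d : Fin n → ℝ => ∑ i, d i) hF.1
  have hX0 : 0 ≤ X.trace := Finset.sum_nonneg fun i _ => hXpos.diag_nonneg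
  have h5 : r * ε * X.trace ≤ c * X.trace := mul_le_mul_of_nonneg_right hrε hX0
  rw [le_div_iff₀ hc]
  linarith

theorem isCompact_feasible : IsCompact
    {p : Matrix (Fin n) (Fin n) ℝ × Matrix (Fin n) (Fin m) ℝ | E.Feasible p.1 p.2} := by
  obtain ⟨B, hB⟩ := exists_trace_le hE
  set D := B + E.Z.trace
  have hZ0 : 0 ≤ E.Z.trace := Finset.sum_nonneg fun i _ => hE.posSemidef.diag_nonneg
  have hbox : IsCompact
      ((Set.univ.pi fun _ => Set.univ.pi fun _ => Set.Icc (-D) D : Set (Matrix (Fin n) (Fin n) ℝ)) ×ˢ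
        (Set.univ.pi fun _ => Set.univ.pi fun _ => Set.Icc (-D) D : Set (Matrix (Fin n) (Fin m) ℝ))) :=
    (isCompact_univ_pi fun _ => isCompact_univ_pi fun _ => isCompact_Icc).prod
      (isCompact_univ_pi fun _ => isCompact_univ_pi fun _ => isCompact_Icc)
  have hclosed : IsClosed
      {p : Matrix (Fin n) (Fin n) ℝ × Matrix (Fin n) (Fin m) ℝ | E.Feasible p.1 p.2} := by
    have hM : Continuous fun p : Matrix (Fin n) (Fin n) ℝ × Matrix (Fin n) (Fin m) ℝ =>
        E.momentMatrix p.1 p.2 :=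
      continuous_fst.matrix_fromBlocks continuous_snd continuous_snd.matrix_transpose
        continuous_const
    simp only [Feasible, Matrix.posSemidef_iff_dotProduct_mulVec, Matrix.IsHermitian]
    refine IsClosed.and (isClosed_eq (by fun_prop) (by fun_prop))
      (IsClosed.and (isClosed_eq hM.matrix_conjTranspose hM) ?_)
    simp only [Set.ofPred_forall]
    exact isClosed_iInter fun x => isClosed_le continuous_const
      (continuous_const.dotProduct (hM.matrix_mulVec continuous_const))
  refine hbox.of_isClosed_subset hclosed fun (p : Matrix (Fin n) (Fin n) ℝ × Matrix (Fin n) (Fin m) ℝ) hp => ?_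
  have hXpos : Matrix.PosSemidef p.1 := hp.2.submatrix Sum.inl
  have htr : p.1.trace ≤ B := hB _ _ hp
  have hdiag : ∀ s, E.momentMatrix p.1 p.2 s s ≤ D := by
    rintro (i | k)
    · have h := Finset.single_le_sum (f := fun i => p.1 i i) (fun j _ => hXpos.diag_nonneg)
        (Finset.mem_univ i)
      change p.1 i i ≤ D
      exact (h.trans htr).trans (le_add_of_nonneg_right hZ0)
    · have h := Finset.single_le_sum (f := fun k => E.Z k k)
        (fun j _ => hE.posSemidef.diag_nonneg) (Finset.mem_univ k)
      have h0 : 0 ≤ p.1.trace := Finset.sum_nonneg fun i _ => hXpos.diag_nonneg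
      change E.Z k k ≤ D
      exact h.trans (le_add_of_nonneg_left (h0.trans htr))
  -- Positive semidefiniteness bounds every entry by the average of two diagonal ones.
  have hentry : ∀ s t, E.momentMatrix p.1 p.2 s t ∈ Set.Icc (-D) D := by
    intro s t
    have h := hp.2.two_mul_abs_apply_le s t one_pos
    rw [one_mul, div_one] at h
    exact abs_le.mp (by linarith [hdiag s, hdiag t])
  exact ⟨fun i _ j _ => hentry (Sum.inl i) (Sum.inl j),
    fun i _ k _ => hentry (Sum.inl i) (Sum.inr k)⟩

/-- This is the covariance when nothing is disclosed; it makes the feasible set nonempty. -/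
theorem feasible_zero : E.Feasible 0 0 := by
  refine ⟨by simp, .of_dotProduct_mulVec_nonneg ?_ fun x => ?_⟩
  · have h : E.Zᴴ = E.Z := hE.posSemidef.isHermitian
    simp only [Matrix.IsHermitian, momentMatrix, Matrix.fromBlocks_conjTranspose, h]
    simp
  · have h := hE.posSemidef.dotProduct_mulVec_nonneg (x ∘ Sum.inr)
    simpa [momentMatrix, Matrix.fromBlocks_mulVec, dotProduct, Fintype.sum_sum_type] using h

/-- The covariance part of the designer's value has a maximizer among feasible pairs. -/
theorem exists_isMax_feasible : ∃ (X : Matrix (Fin n) (Fin n) ℝ) (Y : Matrix (Fin n) (Fin m) ℝ),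
    E.Feasible X Y ∧ ∀ X' Y', E.Feasible X' Y' →
      ∑ p, ∑ q, E.objMatrix p q * E.momentMatrix X' Y' p q ≤
        ∑ p, ∑ q, E.objMatrix p q * E.momentMatrix X Y p q := by
  have hcont : Continuous fun P : Matrix (Fin n) (Fin n) ℝ × Matrix (Fin n) (Fin m) ℝ =>
      ∑ p, ∑ q, E.objMatrix p q * E.momentMatrix P.1 P.2 p q := by
    have hM : Continuous fun p : Matrix (Fin n) (Fin n) ℝ × Matrix (Fin n) (Fin m) ℝ =>
        E.momentMatrix p.1 p.2 :=
      continuous_fst.matrix_fromBlocks continuous_snd continuous_snd.matrix_transpose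
        continuous_const
    exact continuous_finsetSum _ fun p _ => continuous_finsetSum _ fun q _ =>
      continuous_const.mul (hM.matrix_elem p q)
  obtain ⟨P, hP, hmax⟩ := (isCompact_feasible hE).exists_isMaxOn ⟨(0, 0), feasible_zero hE⟩
    hcont.continuousOn
  exact ⟨P.1, P.2, hP, fun X' Y' h => hmax (a := (X', Y')) h⟩

end Environment

end LQG

/-! ### Implementation and optimality -/

theorem proposition1 {n m : ℕ} (E : LQG.Environment n m) (hE : E.BasicAssumption) :
    (∃ π : LQG.InfoStructure E (fun _ : Fin n => ℝ),
      π.IsGaussian ∧ LQG.InfoStructure.IsOptimal.{0, v} π) ∧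
    (∀ (S : Fin n → Type v) [∀ i, MeasurableSpace (S i)] (π : LQG.InfoStructure E S)
      (σ : ∀ i, S i → ℝ), π.IsBNE σ →
      ∃ (X : Matrix (Fin n) (Fin n) ℝ) (Y : Matrix (Fin n) (Fin m) ℝ),
        E.Feasible X Y ∧ π.actionStateCov σ = E.momentMatrix X Y) ∧
    (∀ (X : Matrix (Fin n) (Fin n) ℝ) (Y : Matrix (Fin n) (Fin m) ℝ), E.Feasible X Y →
      ∃ π : LQG.InfoStructure E (fun _ : Fin n => ℝ),
        π.IsGaussian ∧ (∃ σ, π.IsBNE σ) ∧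
          ∀ σ, π.IsBNE σ → π.actionStateCov σ = E.momentMatrix X Y) := by
  -- Essential uniqueness carries the covariance of obedient play over to every equilibrium of the
  -- recommendation structure.
  have hcov : ∀ {X : Matrix (Fin n) (Fin n) ℝ} {Y : Matrix (Fin n) (Fin m) ℝ}
      (hF : E.Feasible X Y) {σ : Fin n → ℝ → ℝ}, (E.recommendation hF.2 hE.posSemidef).IsBNE σ →
      (E.recommendation hF.2 hE.posSemidef).actionStateCov σ = E.momentMatrix X Y :=
    fun hF _ hσ => (hσ.actionStateCov_eq hE (LQG.Environment.isBNE_recommendation hE hF)).trans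
      (LQG.Environment.actionStateCov_recommendation hF.2 hE.posSemidef)
  refine ⟨?_, fun S _ π σ hσ => hσ.exists_feasible hE, fun X Y hF =>
    ⟨E.recommendation hF.2 hE.posSemidef, LQG.Environment.isGaussian_recommendation _ _,
      ⟨_, LQG.Environment.isBNE_recommendation hE hF⟩, fun σ hσ => hcov hF hσ⟩⟩
  obtain ⟨X, Y, hF, hmax⟩ := LQG.Environment.exists_isMax_feasible hE
  refine ⟨E.recommendation hF.2 hE.posSemidef, LQG.Environment.isGaussian_recommendation _ _,
    ⟨_, LQG.Environment.isBNE_recommendation hE hF⟩, fun σ hσ T _ π' σ' hσ' => ?_⟩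
  obtain ⟨X', Y', hF', hM'⟩ := hσ'.exists_feasible hE
  -- Both values contain the same constant, the objective at the common mean, so only the covariance
  -- functionals are compared.
  rw [hσ'.value_eq hE, hσ.value_eq hE, hM', hcov hF hσ]
  exact add_le_add_left (hmax X' Y' hF') _
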